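/- Let a finite group \(G\) act on a finite set \(\mathcal X\). The Burnside process is the Markov chain on \(\mathcal X\) which from \(x\) picks \(g\) uniformly from the stabilizer \(G_x\) and then moves to a uniformly chosen point of \(\mathcal X^g=\{y: y^g=y\}\); its transition kernel is \[P(x,y)=\frac1{|G_x|}\sum_{g\in G_x\cap G_y}\frac1{|\mathcal X^g|},\] and its stationary distribution is \(\pi(x)=\frac{1}{Z|\mathcal O_x|}\), where \(\mathcal O_x\) is the orbit of \(x\) and \(Z\) is the number of orbits. Let \(d(t)=\max_{x\in\mathcal X}\|P^t(x,\cdot)-\pi\|_{\mathrm{TV}}\) for \(t\in\mathbb N\) (with \(P^0\) the identity matrix), and \(d(t)=d(\lfloor t\rfloor)\) for real \(t\ge 0\), \(d(t)=d(0)\) for \(t<0\). For a prime \(p\), the Sylow--Burnside process on the symmetric group \(S_n\) is the Burnside process for \(\mathcal X=S_n\) and \(G=H\times H\), where \(H\) is a Sylow \(p\)-subgroup of \(S_n\), acting by \(\sigma^{(h,g)}=h^{-1}\sigma g\). A sequence of chains with worst-case distances \(d_m\) has cutoff at \((t_m)\) if \(d_m((1+\varepsilon)t_m)\to0\) for all \(\varepsilon>0\)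 and \(d_m((1-\varepsilon)t_m)\to1\) for all \(0<\varepsilon<1\). It has cutoff at \((t_m)\) with window \((w_m)\) if \(w_m=o(t_m)\), \(\lim_{c\to\infty}\limsup_m d_m(t_m+cw_m)=0\) and \(\lim_{c\to-\infty}\liminf_m d_m(t_m+cw_m)=1\). **Theorem.** Let \((p_m)\) be a sequence of primes with \(p_m\to\infty\), and let \((k_m)\) be a sequence of positive integers with \(k_m<p_m\) for all \(m\). For each \(m\) let \(d_m(t)\) be the function \(d(t)\) of the Sylow--Burnside process on \(S_{p_mk_m}\) for the prime \(p_m\) (with any choice of Sylow \(p_m\)-subgroup). 1. If \(k_m=k\) for all large \(m\), then for all \(c\ge0\), \(d_m(c\,p_m)\to 1-(1-e^{-c})^k\) as \(m\to\infty\). In this case there is no sequence of real numbers \((t_m)\) at which the chains have cutoff. 2. If \(k_m\to\infty\), then for all \(c\in\mathbb R\), \(d_m(p_m\log k_m+c\,p_m)\to 1-\exp(-e^{-c})\) as \(m\to\infty\). In this case the chains have cutoff at \((p_m\log k_m)\), and they have cutoff at \((p_m\log k_m)\) with window \((p_m)\). -/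

import Mathlib

open Filter Topology Asymptotics

noncomputable section

namespace Burnside

open Classical in
/-- The transition matrix of the Burnside process of a finite group `G` acting on a finite set `X`:
`P(x, y) = |G_x|⁻¹ * ∑_{g ∈ G_x ∩ G_y} |X^g|⁻¹`, where `G_x` is the stabilizer of `x` and `X^g` is
the set of points fixed by `g`. (From `x`, choose `g` uniformly in `G_x`, then `y` uniformly
in `X^g`.) -/
def kernel (G X : Type*) [Group G] [Fintype G] [MulAction G X] : Matrix X X ℝ :=
  Matrix.of fun x y =>
    (1 / (Nat.card (MulAction.stabilizer G x) : ℝ)) *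
      ∑ g : G with g ∈ MulAction.stabilizer G x ∧ g ∈ MulAction.stabilizer G y,
        1 / (Nat.card (MulAction.fixedBy X g) : ℝ)

/-- The stationary distribution of the Burnside process, `π(x) = 1 / (Z |O_x|)`, where `O_x` is the
orbit of `x` and `Z` is the number of orbits. -/
def stationary (G X : Type*) [Group G] [MulAction G X] (x : X) : ℝ :=
  1 / ((Nat.card (MulAction.orbitRel.Quotient G X) : ℝ) * (Nat.card (MulAction.orbit G x) : ℝ))

/-- The total variation distance between two probability mass functions on a finite set. -/
def tvDist {X : Type*} [Fintype X] (μ ν : X → ℝ) : ℝ :=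
  (1 / 2) * ∑ y, |μ y - ν y|

open Classical in
/-- `d(t) = max_x ‖P^t_x - π‖_TV` for the Burnside process, where `P^t_x = P^t(x, ·)` is the law
after `t` steps from `x`. -/
def worstDist (G X : Type*) [Group G] [Fintype G] [Fintype X] [MulAction G X] (t : ℕ) : ℝ :=
  ⨆ x : X, tvDist (fun y => (kernel G X ^ t) x y) (stationary G X)

/-- The right action `σ^{(h, g)} = h⁻¹ σ g` of `H × H` on a group `S`, for a subgroup `H` of `S`.
A right action is an action of the opposite group. Its orbits are the double cosets `H σ H`. -/
instance doubleCosetAction {S : Type*} [Group S] (H : Subgroup S) :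
    MulAction (↥H × ↥H)ᵐᵒᵖ S where
  smul a σ := (a.unop.1 : S)⁻¹ * σ * (a.unop.2 : S)
  one_smul σ := by
    change ((1 : ↥H) : S)⁻¹ * σ * ((1 : ↥H) : S) = σ
    simp
  mul_smul a b σ := by
    change ((b.unop.1 * a.unop.1 : ↥H) : S)⁻¹ * σ * ((b.unop.2 * a.unop.2 : ↥H) : S) =
      (a.unop.1 : S)⁻¹ * ((b.unop.1 : S)⁻¹ * σ * (b.unop.2 : S)) * (a.unop.2 : S)
    simp [mul_assoc]

instance fintypeMulOpposite {α : Type*} [Fintype α] : Fintype αᵐᵒᵖ :=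
  Fintype.ofEquiv α MulOpposite.opEquiv

open Classical in
/-- `d(t)` for the Sylow--Burnside process on `S_n` (the Burnside process of `H × H` acting on `S_n`
by `σ^{(h, g)} = h⁻¹ σ g`, for a Sylow `p`-subgroup `H`), extended to real times by
`d(t) = d(⌊t⌋)`. -/
def sylowDist {p n : ℕ} (H : Sylow p (Equiv.Perm (Fin n))) (t : ℝ) : ℝ :=
  worstDist (↥(H : Subgroup (Equiv.Perm (Fin n))) × ↥(H : Subgroup (Equiv.Perm (Fin n))))ᵐᵒᵖ
    (Equiv.Perm (Fin n)) ⌊t⌋₊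

/-- A sequence of chains with worst-case distances `d m` has cutoff at the times `t m`. -/
def HasCutoffAt (d : ℕ → ℝ → ℝ) (t : ℕ → ℝ) : Prop :=
  (∀ ε : ℝ, 0 < ε → Tendsto (fun m => d m ((1 + ε) * t m)) atTop (𝓝 0)) ∧
  (∀ ε : ℝ, 0 < ε → ε < 1 → Tendsto (fun m => d m ((1 - ε) * t m)) atTop (𝓝 1))

/-- A sequence of chains with worst-case distances `d m` has cutoff at the times `t m` with
window `w m`: `w = o(t)`, `lim_{c → ∞} limsup_m d m (t m + c w m) = 0` and
`lim_{c → -∞} liminf_m d m (t m + c w m) = 1`. -/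
def HasCutoffWindow (d : ℕ → ℝ → ℝ) (t w : ℕ → ℝ) : Prop :=
  w =o[atTop] t ∧
  Tendsto (fun c : ℝ => limsup (fun m => d m (t m + c * w m)) atTop) atTop (𝓝 0) ∧
  Tendsto (fun c : ℝ => liminf (fun m => d m (t m + c * w m)) atTop) atBot (𝓝 1)

end Burnside

end

/-!
The Burnside process on the double cosets of a Sylow `p`-subgroup `H` of `S_{pk}`, `k < p`, is
nearly a pure death process with `k` independent individuals of lifetime about `p`.

The subgroup `H` is generated by `k` disjoint `p`-cycles, so after a relabelling it consists of the
translations of the `k` blocks of `Fin k × ZMod p` (`exists_mulEquiv_map_eq_shiftGroup`). Call a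
block `i` alive at `σ` if `σ` maps some block affinely onto it. The stabilizer of `σ` consists of
the pairs `(h, g)` with `h ∈ H ∩ σ H σ⁻¹` and `g = σ⁻¹ h σ`, and `H ∩ σ H σ⁻¹` is the group of
translations of the living blocks (`exists_conj_iff`). A uniform `h` moves each living block
independently with probability `1 - 1 / p`. All the moved blocks stay alive at the next
permutation, and a block that `h` fixes is alive there with probability at most `p² / p!`, because
the next permutation may be composed with any of the `p!` permutations of that block
(`card_affine_mul_factorial_le`).

The rest only uses this description, `NearlyPureDeath`. With `F t` the probability
`1 - (1 - (1 - 1 / p) ^ t) ^ k` that the pure death process started from `k` individuals is not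
extinct at time `t`, the probability that a block is alive after `t` steps is at most
`F t + t * ε`, and from the identity at least `F t` (`kernel_pow_survival`); here
`ε = k * p² / p!`. By stationarity the stationary mass `δ` of the states with a living block is
tiny. This gives `F t - δ ≤ d(t)`. Conversely, as soon as `h = 1` is chosen, the next state is
uniform on `S_{pk}`, and the uniform law is within `δ` of the stationary law, since the orbits of
states without living blocks have the full size `|H|²`. This gives `d(t) ≤ F t + t * ε + δ`
(`worstDist_le`).

At `t = p (ℓ + c)` with `exp ℓ ≤ p` the errors vanish and `(1 - 1 / p) ^ t` is about
`exp (-(ℓ + c))`. The choices `ℓ = 0` and `ℓ = log k` give the two limit profiles. The statements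
on cutoff follow from the profiles because `d` is antitone.
-/

namespace Burnside

/-! ### Total variation distance -/

section TotalVariation

variable {X : Type*} [Fintype X]

theorem tvDist_nonneg (μ ν : X → ℝ) : 0 ≤ tvDist μ ν :=
  mul_nonneg (by norm_num) (Finset.sum_nonneg fun _ _ => abs_nonneg _)

theorem tvDist_le_one {μ ν : X → ℝ} (hμ : ∀ x, 0 ≤ μ x) (hν : ∀ x, 0 ≤ ν x)
    (hμ1 : ∑ x, μ x = 1) (hν1 : ∑ x, ν x = 1) : tvDist μ ν ≤ 1 := by
  have h : ∑ y, |μ y - ν y| ≤ ∑ y, (μ y + ν y) := Finset.sum_le_sum fun y _ => by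
    rw [abs_le]; constructor <;> linarith [hμ y, hν y]
  rw [Finset.sum_add_distrib, hμ1, hν1] at h
  unfold tvDist; linarith

theorem tvDist_eq_sum_max {μ ν : X → ℝ} (h : ∑ x, μ x = ∑ x, ν x) :
    tvDist μ ν = ∑ x, max (ν x - μ x) 0 := by
  have h2 : ∑ x, |μ x - ν x| = ∑ x, (2 * max (ν x - μ x) 0 + (μ x - ν x)) := by
    refine Finset.sum_congr rfl fun x _ => ?_
    rcases le_total (μ x) (ν x) with h | h
    · rw [max_eq_left (by linarith), abs_of_nonpos (by linarith)]; ring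
    · rw [max_eq_right (by linarith), abs_of_nonneg (by linarith)]; ring
  rw [tvDist, h2, Finset.sum_add_distrib, Finset.sum_sub_distrib, h, ← Finset.mul_sum]
  ring

theorem sum_sub_sum_le_tvDist {μ ν : X → ℝ} (h : ∑ x, μ x = ∑ x, ν x) (A : Finset X) :
    ∑ x ∈ A, μ x - ∑ x ∈ A, ν x ≤ tvDist μ ν := by
  have hs : tvDist μ ν = tvDist ν μ := by simp only [tvDist, abs_sub_comm]
  rw [hs, tvDist_eq_sum_max h.symm, ← Finset.sum_sub_distrib]
  calc ∑ x ∈ A, (μ x - ν x) ≤ ∑ x ∈ A, max (μ x - ν x) 0 :=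
        Finset.sum_le_sum fun x _ => le_max_left _ _
    _ ≤ _ := Finset.sum_le_sum_of_subset_of_nonneg (Finset.subset_univ _)
        fun x _ _ => le_max_right _ _

/-- Total variation distance to a fixed law is convex in the other law. -/
theorem tvDist_sum_smul_le {ι : Type*} [Fintype ι] (w : ι → ℝ) (hw : ∀ i, 0 ≤ w i)
    (hw1 : ∑ i, w i = 1) (μ : ι → X → ℝ) (ν : X → ℝ) :
    tvDist (fun y => ∑ i, w i * μ i y) ν ≤ ∑ i, w i * tvDist (μ i) ν := by
  unfold tvDist
  calc (1 / 2) * ∑ y, |∑ i, w i * μ i y - ν y|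
      ≤ (1 / 2) * ∑ y, ∑ i, w i * |μ i y - ν y| := by
        gcongr with y
        have : ∑ i, w i * μ i y - ν y = ∑ i, w i * (μ i y - ν y) := by
          simp only [mul_sub, Finset.sum_sub_distrib, ← Finset.sum_mul, hw1, one_mul]
        rw [this]
        refine (Finset.abs_sum_le_sum_abs _ _).trans_eq ?_
        exact Finset.sum_congr rfl fun i _ => by rw [abs_mul, abs_of_nonneg (hw i)]
    _ = _ := by
        rw [Finset.sum_comm, Finset.mul_sum]
        refine Finset.sum_congr rfl fun i _ => ?_
        rw [← Finset.mul_sum]; ring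

/-- A stochastic matrix contracts total variation distance. -/
theorem tvDist_vecMul_le (M : Matrix X X ℝ) (hM : ∀ x y, 0 ≤ M x y) (hM1 : ∀ x, ∑ y, M x y = 1)
    (μ ν : X → ℝ) : tvDist (Matrix.vecMul μ M) (Matrix.vecMul ν M) ≤ tvDist μ ν := by
  unfold tvDist
  refine mul_le_mul_of_nonneg_left ?_ (by norm_num)
  calc ∑ y, |Matrix.vecMul μ M y - Matrix.vecMul ν M y|
      ≤ ∑ y, ∑ x, |μ x - ν x| * M x y := by
        gcongr with y
        simp only [Matrix.vecMul, dotProduct, ← Finset.sum_sub_distrib, ← sub_mul]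
        refine (Finset.abs_sum_le_sum_abs _ _).trans_eq ?_
        exact Finset.sum_congr rfl fun i _ => by rw [abs_mul, abs_of_nonneg (hM _ _)]
    _ = _ := by
        rw [Finset.sum_comm]
        simp only [← Finset.mul_sum, hM1, mul_one]

end TotalVariation

/-! ### The Burnside process of a finite group action -/

section Chain

variable {G X : Type*} [Group G] [MulAction G X]

open Classical in
/-- One step of the Burnside process, applied to a function: average over the stabilizer, then
over the fixed points. -/
theorem kernel_mulVec [Fintype G] [Fintype X] (F : X → ℝ) (x : X) :
    Matrix.mulVec (kernel G X) F x =
      (1 / (Nat.card (MulAction.stabilizer G x) : ℝ)) *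
        ∑ g : G with g • x = x, (1 / (Nat.card (MulAction.fixedBy X g) : ℝ)) *
          ∑ y : X with g • y = y, F y := by
  simp only [Matrix.mulVec, dotProduct, kernel, Matrix.of_apply, mul_assoc, ← Finset.mul_sum]
  congr 1
  simp only [MulAction.mem_stabilizer_iff, Finset.sum_mul, Finset.sum_filter, Finset.mul_sum]
  rw [Finset.sum_comm]
  refine Finset.sum_congr rfl fun g _ => ?_
  split_ifs with h
  · refine Finset.sum_congr rfl fun y _ => ?_
    by_cases h' : g • y = y <;> simp [h, h']
  · simp [h]

open Classical in
theorem card_fixedBy_eq [Fintype X] (g : G) :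
    Nat.card (MulAction.fixedBy X g) = (Finset.univ.filter fun y : X => g • y = y).card := by
  rw [Nat.card_eq_fintype_card, ← Set.toFinset_card]
  congr 1; ext; simp

open Classical in
theorem card_stabilizer_eq [Fintype G] (x : X) :
    Nat.card (MulAction.stabilizer G x) = (Finset.univ.filter fun g : G => g • x = x).card := by
  rw [Nat.card_eq_fintype_card, Fintype.card_subtype]
  simp [MulAction.mem_stabilizer_iff]

theorem card_fixedBy_pos [Finite X] {g : G} {x : X} (h : g • x = x) :
    (0 : ℝ) < Nat.card (MulAction.fixedBy X g) := by
  have : Nonempty (MulAction.fixedBy X g) := ⟨⟨x, h⟩⟩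
  exact_mod_cast Nat.card_pos

theorem card_stabilizer_pos [Fintype G] (x : X) : (0 : ℝ) < Nat.card (MulAction.stabilizer G x) := by
  exact_mod_cast Nat.card_pos

theorem kernel_nonneg [Fintype G] (x y : X) : 0 ≤ kernel G X x y := by
  simp only [kernel, Matrix.of_apply]
  positivity

theorem stationary_nonneg (x : X) : 0 ≤ stationary G X x := by
  rw [stationary]; positivity

variable [Fintype G] [Fintype X]

theorem kernel_sum (x : X) : ∑ y, kernel G X x y = 1 := by
  classical
  have h := kernel_mulVec (G := G) (fun _ : X => (1 : ℝ)) x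
  simp only [Matrix.mulVec, dotProduct, mul_one, Finset.sum_const, nsmul_eq_mul] at h
  rw [h, Finset.sum_congr rfl (g := fun _ => (1 : ℝ))]
  · rw [Finset.sum_const, nsmul_eq_mul, mul_one, ← card_stabilizer_eq]
    exact one_div_mul_cancel (card_stabilizer_pos x).ne'
  · intro g hg
    rw [← card_fixedBy_eq]
    exact one_div_mul_cancel (card_fixedBy_pos (Finset.mem_filter.1 hg).2).ne'

open Classical in
theorem kernel_pow_nonneg (t : ℕ) (x y : X) : 0 ≤ (kernel G X ^ t) x y := by
  induction t generalizing x with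
  | zero => rw [pow_zero, Matrix.one_apply]; split_ifs <;> norm_num
  | succ t ih =>
    rw [pow_succ', Matrix.mul_apply]
    exact Finset.sum_nonneg fun z _ => mul_nonneg (kernel_nonneg _ _) (ih z)

open Classical in
theorem kernel_pow_sum (t : ℕ) (x : X) : ∑ y, (kernel G X ^ t) x y = 1 := by
  induction t generalizing x with
  | zero => simp [Matrix.one_apply]
  | succ t ih =>
    simp only [pow_succ', Matrix.mul_apply]
    rw [Finset.sum_comm]
    simp only [← Finset.mul_sum, ih, mul_one, kernel_sum]

/-- Burnside's lemma, with the sum over the group written as a real number. -/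
theorem card_orbits_mul_card :
    (Nat.card (MulAction.orbitRel.Quotient G X) : ℝ) * Nat.card G =
      ∑ g : G, (Nat.card (MulAction.fixedBy X g) : ℝ) := by
  classical
  have h := MulAction.sum_card_fixedBy_eq_card_orbits_mul_card_group G X
  simp only [← Nat.card_eq_fintype_card] at h
  exact_mod_cast h.symm

theorem stationary_eq (x : X) : stationary G X x =
    (Nat.card (MulAction.stabilizer G x) : ℝ) /
      ((Nat.card (MulAction.orbitRel.Quotient G X) : ℝ) * Nat.card G) := by
  classical
  have h := MulAction.card_orbit_mul_card_stabilizer_eq_card_group G x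
  simp only [← Nat.card_eq_fintype_card] at h
  rw [stationary, ← h]
  have := card_stabilizer_pos (G := G) x
  push_cast
  field_simp

theorem card_le_card_orbits_mul_card :
    (Nat.card X : ℝ) ≤ (Nat.card (MulAction.orbitRel.Quotient G X) : ℝ) * Nat.card G := by
  classical
  rw [card_orbits_mul_card]
  refine le_trans (le_of_eq ?_) (Finset.single_le_sum
    (f := fun g : G => (Nat.card (MulAction.fixedBy X g) : ℝ))
    (fun _ _ => Nat.cast_nonneg _) (Finset.mem_univ (1 : G)))
  simp

theorem stationary_sum [Nonempty X] : ∑ x, stationary G X x = 1 := by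
  classical
  simp only [stationary_eq, ← Finset.sum_div]
  have hpos : (0 : ℝ) < (Nat.card (MulAction.orbitRel.Quotient G X) : ℝ) * Nat.card G :=
    lt_of_lt_of_le (by exact_mod_cast Nat.card_pos) card_le_card_orbits_mul_card
  rw [div_eq_one_iff_eq hpos.ne', card_orbits_mul_card]
  simp only [card_stabilizer_eq, card_fixedBy_eq, Finset.card_filter, Nat.cast_sum]
  exact Finset.sum_comm

theorem stationary_mul_kernel_comm (x y : X) :
    stationary G X x * kernel G X x y = stationary G X y * kernel G X y x := by
  classical
  have hx := card_stabilizer_pos (G := G) x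
  have hy := card_stabilizer_pos (G := G) y
  simp only [stationary_eq, kernel, Matrix.of_apply, and_comm]
  field_simp

theorem stationary_vecMul_kernel : Matrix.vecMul (stationary G X) (kernel G X) =
    stationary G X := by
  ext y
  simp only [Matrix.vecMul, dotProduct]
  simp only [stationary_mul_kernel_comm _ y, ← Finset.mul_sum, kernel_sum, mul_one]

open Classical in
theorem stationary_vecMul_kernel_pow (t : ℕ) :
    Matrix.vecMul (stationary G X) (kernel G X ^ t) = stationary G X := by
  induction t with
  | zero => simp
  | succ t ih => rw [pow_succ, ← Matrix.vecMul_vecMul, ih, stationary_vecMul_kernel]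

open Classical in
theorem tvDist_le_worstDist (t : ℕ) (x : X) :
    tvDist (fun y => (kernel G X ^ t) x y) (stationary G X) ≤ worstDist G X t :=
  le_ciSup (f := fun x : X => tvDist (fun y => (kernel G X ^ t) x y) (stationary G X))
    (Set.finite_range _).bddAbove x

theorem worstDist_nonneg (t : ℕ) : 0 ≤ worstDist G X t :=
  Real.iSup_nonneg fun _ => tvDist_nonneg _ _

theorem worstDist_le_one [Nonempty X] (t : ℕ) : worstDist G X t ≤ 1 := by
  classical
  exact ciSup_le fun x => tvDist_le_one (kernel_pow_nonneg t x) stationary_nonneg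
    (kernel_pow_sum t x) stationary_sum

theorem worstDist_antitone [Nonempty X] : Antitone (worstDist G X) := by
  classical
  refine antitone_nat_of_succ_le fun t => ciSup_le fun x => ?_
  refine le_trans ?_ (tvDist_le_worstDist t x)
  have h := tvDist_vecMul_le (kernel G X) kernel_nonneg kernel_sum
    (fun y => (kernel G X ^ t) x y) (stationary G X)
  rw [stationary_vecMul_kernel] at h
  rw [pow_succ]
  exact h

/-- The worst-case distance does not change under an isomorphism of group actions. -/
theorem worstDist_congr {G' X' : Type*} [Group G'] [Fintype G'] [Fintype X'] [MulAction G' X']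
    (φ : G ≃* G') (e : X ≃ X') (h : ∀ g x, e (g • x) = φ g • e x) (t : ℕ) :
    worstDist G X t = worstDist G' X' t := by
  classical
  have hfix : ∀ g x, φ g • e x = e x ↔ g • x = x := fun g x => by
    rw [← h, e.apply_eq_iff_eq]
  have hstab : ∀ x, Nat.card (MulAction.stabilizer G' (e x)) =
      Nat.card (MulAction.stabilizer G x) := fun x => by
    refine (Nat.card_congr (φ.toEquiv.subtypeEquiv fun g => ?_)).symm
    exact (hfix g x).symm
  have hfixed : ∀ g, Nat.card (MulAction.fixedBy X' (φ g)) = Nat.card (MulAction.fixedBy X g) :=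
    fun g => by
      refine (Nat.card_congr (e.subtypeEquiv fun x => ?_)).symm
      exact (hfix g x).symm
  have hk : ∀ x y, kernel G' X' (e x) (e y) = kernel G X x y := fun x y => by
    simp only [kernel, Matrix.of_apply, hstab, Finset.sum_filter]
    congr 1
    rw [← φ.toEquiv.sum_comp]
    simp [MulAction.mem_stabilizer_iff, hfix, hfixed, -Nat.card_eq_fintype_card]
  have hZ : (Nat.card (MulAction.orbitRel.Quotient G' X') : ℝ) * Nat.card G' =
      (Nat.card (MulAction.orbitRel.Quotient G X) : ℝ) * Nat.card G := by
    simp only [card_orbits_mul_card]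
    rw [← φ.toEquiv.sum_comp]
    exact Finset.sum_congr rfl fun g _ => congrArg _ (hfixed g)
  have hs : ∀ x, stationary G' X' (e x) = stationary G X x := fun x => by
    rw [stationary_eq, stationary_eq, hZ, hstab]
  have hpow : ∀ (t : ℕ) x y, (kernel G' X' ^ t) (e x) (e y) = (kernel G X ^ t) x y := by
    intro t
    induction t with
    | zero => intro x y; simp [Matrix.one_apply]
    | succ t ih =>
      intro x y
      rw [pow_succ, pow_succ, Matrix.mul_apply, Matrix.mul_apply, ← e.sum_comp]
      simp [ih, hk]
  unfold worstDist
  rw [← e.iSup_comp]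
  congr 1
  ext x
  simp only [tvDist]
  rw [← e.sum_comp]
  simp only [hpow, hs]

end Chain

/-! ### Burnside processes close to a pure death process -/

/-- The probability that a population of `n` individuals, each dying independently with
probability `1 / p` at every step, is not extinct at time `s`. -/
noncomputable def survival (p s n : ℕ) : ℝ := 1 - (1 - (1 - 1 / (p : ℝ)) ^ s) ^ n

section Survival

variable {p : ℕ}

theorem one_sub_inv_mem_Icc (p : ℕ) : 0 ≤ 1 - 1 / (p : ℝ) ∧ 1 - 1 / (p : ℝ) ≤ 1 := by
  have h1 : 1 / (p : ℝ) ≤ 1 := by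
    simpa using Nat.cast_inv_le_one (α := ℝ) p
  have h2 : 0 ≤ 1 / (p : ℝ) := by positivity
  constructor <;> linarith

theorem one_sub_pow_mem_Icc (p s : ℕ) :
    0 ≤ 1 - (1 - 1 / (p : ℝ)) ^ s ∧ 1 - (1 - 1 / (p : ℝ)) ^ s ≤ 1 := by
  obtain ⟨h0, h1⟩ := one_sub_inv_mem_Icc p
  have h2 := pow_le_one₀ (n := s) h0 h1
  have h3 := pow_nonneg h0 s
  constructor <;> linarith

theorem survival_nonneg (p s n : ℕ) : 0 ≤ survival p s n := by
  obtain ⟨h0, h1⟩ := one_sub_pow_mem_Icc p s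
  exact sub_nonneg.2 (pow_le_one₀ h0 h1)

theorem survival_le_one (p s n : ℕ) : survival p s n ≤ 1 := by
  obtain ⟨h0, h1⟩ := one_sub_pow_mem_Icc p s
  have := pow_nonneg h0 n
  unfold survival; linarith

theorem survival_mono_right (p s : ℕ) : Monotone (survival p s) := fun m n h => by
  obtain ⟨h0, h1⟩ := one_sub_pow_mem_Icc p s
  have := pow_le_pow_of_le_one h0 h1 h
  unfold survival; linarith

theorem survival_zero_left (p n : ℕ) : survival p 0 n = if n = 0 then 0 else 1 := by
  by_cases h : n = 0 <;> simp [survival, h]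

theorem survival_le_mul (p s n : ℕ) : survival p s n ≤ n * (1 - 1 / (p : ℝ)) ^ s := by
  obtain ⟨h0, h1⟩ := one_sub_pow_mem_Icc p s
  have h := one_add_mul_le_pow (a := -(1 - 1 / (p : ℝ)) ^ s) (by linarith) n
  have e : (1 : ℝ) + -(1 - 1 / (p : ℝ)) ^ s = 1 - (1 - 1 / (p : ℝ)) ^ s := by ring
  rw [e] at h
  unfold survival; linarith

end Survival

open Classical in
/-- The action of `G` on `X` makes the number `N` of living individuals nearly a pure death
process: from `x`, the chosen group element `g` selects `r g` survivors, distributed as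
`Binomial (N x) (1 - 1 / p)`, and the next state `y` has `N y = r g` with probability at least
`1 - ε`. The Binomial law is expressed through its generating function. -/
structure NearlyPureDeath (G X : Type*) [Group G] [Fintype G] [Fintype X] [MulAction G X]
    (p k : ℕ) (ε : ℝ) (N : X → ℕ) (r : G → ℕ) : Prop where
  pos : 0 < p
  eps_nonneg : 0 ≤ ε
  count_le : ∀ x, N x ≤ k
  exists_count_eq : ∃ x, N x = k
  le_count : ∀ g x, g • x = x → r g ≤ N x
  sum_pow : ∀ (x : X) (u : ℝ), ∑ g : G with g • x = x, u ^ r g = (1 + (p - 1) * u) ^ N x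
  card_le : ∀ g : G, ((Finset.univ.filter fun y : X => g • y = y ∧ N y ≠ r g).card : ℝ) ≤
    ε * (Finset.univ.filter fun y : X => g • y = y).card

namespace NearlyPureDeath

variable {G X : Type*} [Group G] [Fintype G] [Fintype X] [MulAction G X]
  {p k : ℕ} {ε : ℝ} {N : X → ℕ} {r : G → ℕ}

theorem card_stabilizer (h : NearlyPureDeath G X p k ε N r) (x : X) :
    (Nat.card (MulAction.stabilizer G x) : ℝ) = (p : ℝ) ^ N x := by
  classical
  have := h.sum_pow x 1
  rw [card_stabilizer_eq]
  simpa using this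

open Classical in
/-- Averaging over the binomial law of the number of survivors is one step of the pure death
process. -/
theorem mean_survival (h : NearlyPureDeath G X p k ε N r) (s : ℕ) (x : X) :
    (1 / (Nat.card (MulAction.stabilizer G x) : ℝ)) *
      ∑ g : G with g • x = x, survival p s (r g) = survival p (s + 1) (N x) := by
  have hp : (0 : ℝ) < p := by exact_mod_cast h.pos
  have h1 : (Finset.univ.filter fun g : G => g • x = x).card = (p : ℝ) ^ N x := by
    rw [← h.card_stabilizer x, card_stabilizer_eq]
  have h2 : 1 + ((p : ℝ) - 1) * (1 - (1 - 1 / (p : ℝ)) ^ s) =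
      p * (1 - (1 - 1 / (p : ℝ)) ^ (s + 1)) := by
    rw [pow_succ]; field_simp; ring
  simp only [survival, Finset.sum_sub_distrib, h.sum_pow, Finset.sum_const, nsmul_eq_mul, mul_one,
    h1, h2, h.card_stabilizer x, mul_pow]
  field_simp

theorem survival_succ_le_kernel (h : NearlyPureDeath G X p k ε N r) (s : ℕ) (x : X) :
    survival p (s + 1) (N x) ≤ Matrix.mulVec (kernel G X) (fun y => survival p s (N y)) x := by
  classical
  rw [kernel_mulVec, ← h.mean_survival]
  refine mul_le_mul_of_nonneg_left (Finset.sum_le_sum fun g hg => ?_) (by positivity)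
  have hg := (Finset.mem_filter.1 hg).2
  rw [one_div, le_inv_mul_iff₀ (card_fixedBy_pos hg), card_fixedBy_eq, ← nsmul_eq_mul,
    ← Finset.sum_const]
  exact Finset.sum_le_sum fun y hy =>
    survival_mono_right p s (h.le_count g y (Finset.mem_filter.1 hy).2)

theorem kernel_survival_le (h : NearlyPureDeath G X p k ε N r) (s : ℕ) (x : X) :
    Matrix.mulVec (kernel G X) (fun y => survival p s (N y)) x ≤ survival p (s + 1) (N x) + ε := by
  classical
  have key : ∀ g : G, g • x = x → (1 / (Nat.card (MulAction.fixedBy X g) : ℝ)) *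
      ∑ y : X with g • y = y, survival p s (N y) ≤ survival p s (r g) + ε := fun g hg => by
    rw [one_div, inv_mul_le_iff₀ (card_fixedBy_pos hg), card_fixedBy_eq]
    calc ∑ y : X with g • y = y, survival p s (N y)
        ≤ ∑ y : X with g • y = y, (survival p s (r g) + if N y ≠ r g then 1 else 0) := by
          refine Finset.sum_le_sum fun y _ => ?_
          split_ifs with hN
          · linarith [survival_le_one p s (N y), survival_nonneg p s (r g)]
          · rw [not_not.1 hN, add_zero]
      _ = (Finset.univ.filter fun y : X => g • y = y).card * survival p s (r g) +
            (Finset.univ.filter fun y : X => g • y = y ∧ N y ≠ r g).card := by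
          rw [Finset.sum_add_distrib, Finset.sum_const, nsmul_eq_mul, ← Finset.sum_filter,
            Finset.filter_filter, Finset.sum_const, nsmul_eq_mul, mul_one]
      _ ≤ _ := by linarith [h.card_le g]
  rw [kernel_mulVec, ← h.mean_survival]
  have hpos := card_stabilizer_pos (G := G) x
  calc _ ≤ (1 / (Nat.card (MulAction.stabilizer G x) : ℝ)) *
        ∑ g : G with g • x = x, (survival p s (r g) + ε) :=
        mul_le_mul_of_nonneg_left
          (Finset.sum_le_sum fun g hg => key g (Finset.mem_filter.1 hg).2) (by positivity)
    _ = _ := by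
        rw [Finset.sum_add_distrib, Finset.sum_const, nsmul_eq_mul, ← card_stabilizer_eq]
        field_simp

theorem kernel_mulVec_mono {F F' : X → ℝ} (h : ∀ x, F x ≤ F' x) (x : X) :
    Matrix.mulVec (kernel G X) F x ≤ Matrix.mulVec (kernel G X) F' x :=
  Finset.sum_le_sum fun y _ => mul_le_mul_of_nonneg_left (h y) (kernel_nonneg x y)

theorem kernel_mulVec_add_const (F : X → ℝ) (c : ℝ) (x : X) :
    Matrix.mulVec (kernel G X) (fun y => F y + c) x = Matrix.mulVec (kernel G X) F x + c := by
  simp only [Matrix.mulVec, dotProduct, mul_add, Finset.sum_add_distrib, ← Finset.sum_mul,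
    kernel_sum, one_mul]

open Classical in
/-- The probability that some individual is alive at time `t` is, up to `t * ε`, that of the pure
death process. -/
theorem kernel_pow_survival (h : NearlyPureDeath G X p k ε N r) (t : ℕ) (x : X) :
    survival p t (N x) ≤ Matrix.mulVec (kernel G X ^ t) (fun y => survival p 0 (N y)) x ∧
    Matrix.mulVec (kernel G X ^ t) (fun y => survival p 0 (N y)) x ≤
      survival p t (N x) + t * ε := by
  induction t generalizing x with
  | zero => simp
  | succ t ih =>
    rw [pow_succ', ← Matrix.mulVec_mulVec]
    constructor
    · exact (h.survival_succ_le_kernel t x).trans (kernel_mulVec_mono (fun y => (ih y).1) x)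
    · refine (kernel_mulVec_mono (fun y => (ih y).2) x).trans ?_
      rw [kernel_mulVec_add_const]
      push_cast
      linarith [h.kernel_survival_le t x]

open Classical in
/-- The stationary mass of the states with a living individual. -/
theorem stationary_alive_le (h : NearlyPureDeath G X p k ε N r) (s : ℕ) :
    ∑ x : X with N x ≠ 0, stationary G X x ≤ survival p s k + s * ε := by
  have : Nonempty X := ⟨h.exists_count_eq.choose⟩
  have e : ∑ x : X with N x ≠ 0, stationary G X x =
      stationary G X ⬝ᵥ fun y => survival p 0 (N y) := by
    simp [dotProduct, survival_zero_left, Finset.sum_filter]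
  rw [e, ← stationary_vecMul_kernel_pow s, ← Matrix.dotProduct_mulVec]
  calc _ ≤ ∑ x, stationary G X x * (survival p s k + s * ε) := by
        refine Finset.sum_le_sum fun x _ => mul_le_mul_of_nonneg_left ?_ (stationary_nonneg x)
        linarith [(h.kernel_pow_survival s x).2, survival_mono_right p s (h.count_le x)]
    _ = _ := by rw [← Finset.sum_mul, stationary_sum, one_mul]

open Classical in
/-- The lower bound tests the law started from `k` individuals on the event that some individual is
alive. -/
theorem survival_le_worstDist (h : NearlyPureDeath G X p k ε N r) (t : ℕ) :
    survival p t k - ∑ x : X with N x ≠ 0, stationary G X x ≤ worstDist G X t := by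
  obtain ⟨x, hx⟩ := h.exists_count_eq
  have : Nonempty X := ⟨x⟩
  refine le_trans ?_ (tvDist_le_worstDist t x)
  refine le_trans ?_ (sum_sub_sum_le_tvDist ((kernel_pow_sum t x).trans stationary_sum.symm)
    (Finset.univ.filter fun x => N x ≠ 0))
  refine sub_le_sub_right ?_ _
  have := (h.kernel_pow_survival t x).1
  rw [hx] at this
  refine this.trans_eq ?_
  simp [Matrix.mulVec, dotProduct, survival_zero_left, Finset.sum_filter]

open Classical in
/-- The uniform law is close to the stationary law: outside the states with a living individual
the orbits have the maximal size `|G|`, so that the stationary law is at most uniform there. -/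
theorem tvDist_uniform_le (h : NearlyPureDeath G X p k ε N r) :
    tvDist (fun _ => 1 / (Nat.card X : ℝ)) (stationary G X) ≤
      ∑ x : X with N x ≠ 0, stationary G X x := by
  have : Nonempty X := ⟨h.exists_count_eq.choose⟩
  have hX : (0 : ℝ) < Nat.card X := by exact_mod_cast Nat.card_pos
  rw [tvDist_eq_sum_max, Finset.sum_filter]
  · refine Finset.sum_le_sum fun x _ => ?_
    split_ifs with hN
    · refine max_le ?_ (stationary_nonneg x)
      have : 0 ≤ 1 / (Nat.card X : ℝ) := by positivity
      linarith
    · refine max_le ?_ le_rfl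
      rw [stationary_eq, h.card_stabilizer, not_not.1 hN, pow_zero, sub_nonpos]
      exact one_div_le_one_div_of_le hX card_le_card_orbits_mul_card
  · rw [stationary_sum]
    rw [Finset.sum_const, nsmul_eq_mul, Finset.card_univ, ← Nat.card_eq_fintype_card]
    exact mul_one_div_cancel hX.ne'

theorem uniform_le_kernel (x y : X) :
    (1 / (Nat.card (MulAction.stabilizer G x) : ℝ)) * (1 / (Nat.card X : ℝ)) ≤ kernel G X x y := by
  classical
  simp only [kernel, Matrix.of_apply]
  refine mul_le_mul_of_nonneg_left ?_ (by positivity)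
  have h1 : (1 : G) ∈ Finset.univ.filter
      fun g : G => g ∈ MulAction.stabilizer G x ∧ g ∈ MulAction.stabilizer G y := by
    simp
  refine le_trans (le_of_eq ?_) (Finset.single_le_sum
    (f := fun g : G => 1 / (Nat.card (MulAction.fixedBy X g) : ℝ)) (fun _ _ => by positivity) h1)
  simp [Nat.card_eq_fintype_card]

open Classical in
/-- One step of the upper bound: with probability `1 / |G_x|` the identity is chosen and the next
state is uniform; otherwise the bound `F` for the distance at time `t` is averaged. -/
theorem tvDist_succ_le (t : ℕ) (F : X → ℝ) (δ : ℝ)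
    (hδ : tvDist (fun _ : X => 1 / (Nat.card X : ℝ)) (stationary G X) ≤ δ)
    (hF : ∀ x, tvDist (fun y => (kernel G X ^ t) x y) (stationary G X) ≤ F x) (x : X) :
    tvDist (fun y => (kernel G X ^ (t + 1)) x y) (stationary G X) ≤
      ∑ y, (kernel G X x y - (1 / (Nat.card (MulAction.stabilizer G x) : ℝ)) *
        (1 / (Nat.card X : ℝ))) * F y +
      (1 / (Nat.card (MulAction.stabilizer G x) : ℝ)) * δ := by
  have : Nonempty X := ⟨x⟩
  have hX : (Nat.card X : ℝ) ≠ 0 := by exact_mod_cast Nat.card_pos.ne'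
  set c : ℝ := 1 / (Nat.card (MulAction.stabilizer G x) : ℝ) with hc
  have hc0 : 0 ≤ c := by positivity
  set R : X → ℝ := fun y => kernel G X x y - c * (1 / (Nat.card X : ℝ)) with hR
  have hR0 : ∀ y, 0 ≤ R y := fun y => sub_nonneg.2 (uniform_le_kernel x y)
  have hRsum : ∑ y, R y = 1 - c := by
    simp only [hR, Finset.sum_sub_distrib, kernel_sum, Finset.sum_const, nsmul_eq_mul,
      Finset.card_univ, ← Nat.card_eq_fintype_card]
    field_simp
  have hU : tvDist (Matrix.vecMul (fun _ => 1 / (Nat.card X : ℝ)) (kernel G X ^ t))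
      (stationary G X) ≤ δ := by
    have h := tvDist_vecMul_le (kernel G X ^ t) (kernel_pow_nonneg t) (kernel_pow_sum t)
      (fun _ => 1 / (Nat.card X : ℝ)) (stationary G X)
    rw [stationary_vecMul_kernel_pow] at h
    exact h.trans hδ
  -- The law at time `t + 1` as a mixture over `Option X`, `none` standing for the uniform start.
  have hmix := tvDist_sum_smul_le (ι := Option X) (fun o => o.elim c R)
    (by rintro (_ | y); exacts [hc0, hR0 y]) (by simp [Fintype.sum_option, hRsum])
    (fun o => o.elim (Matrix.vecMul (fun _ => 1 / (Nat.card X : ℝ)) (kernel G X ^ t))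
      fun y z => (kernel G X ^ t) y z) (stationary G X)
  simp only [Fintype.sum_option, Option.elim_none, Option.elim_some] at hmix
  have e : (fun y => (kernel G X ^ (t + 1)) x y) = fun y =>
      c * Matrix.vecMul (fun _ => 1 / (Nat.card X : ℝ)) (kernel G X ^ t) y +
        ∑ z, R z * (kernel G X ^ t) z y := by
    ext y
    simp only [hR, pow_succ', Matrix.mul_apply, sub_mul, Finset.sum_sub_distrib, Matrix.vecMul,
      dotProduct, Finset.mul_sum, mul_assoc]
    ring
  rw [e]
  refine hmix.trans ?_
  rw [add_comm]
  exact add_le_add (Finset.sum_le_sum fun y _ => mul_le_mul_of_nonneg_left (hF y) (hR0 y))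
    (mul_le_mul_of_nonneg_left hU hc0)

open Classical in
/-- Up to the first choice of the identity the bound follows the pure death process. From then on
the distance to the stationary law is at most the stationary mass of the states with a living
individual. -/
theorem worstDist_le (h : NearlyPureDeath G X p k ε N r) (hk : 0 < k) (t : ℕ) :
    worstDist G X t ≤ survival p t k + t * ε + ∑ x : X with N x ≠ 0, stationary G X x := by
  have : Nonempty X := ⟨h.exists_count_eq.choose⟩
  have hX : (Nat.card X : ℝ) ≠ 0 := by exact_mod_cast Nat.card_pos.ne'
  set δ := ∑ x : X with N x ≠ 0, stationary G X x with hδ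
  have hδ0 : 0 ≤ δ := Finset.sum_nonneg fun x _ => stationary_nonneg x
  obtain _ | t := t
  · have := worstDist_le_one (G := G) (X := X) 0
    rw [survival_zero_left, if_neg hk.ne']
    push_cast
    linarith
  have key : ∀ (t : ℕ) (x : X), tvDist (fun y => (kernel G X ^ (t + 1)) x y) (stationary G X) ≤
      survival p (t + 1) (N x) + ((t : ℝ) * ε + δ) := by
    intro t
    induction t with
    | zero =>
      intro x
      have h1 := tvDist_succ_le 0 (fun _ : X => 1) δ h.tvDist_uniform_le
        (fun y => tvDist_le_one (kernel_pow_nonneg 0 y) stationary_nonneg (kernel_pow_sum 0 y)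
          stationary_sum) x
      refine h1.trans ?_
      have hp : (0 : ℝ) < p := by exact_mod_cast h.pos
      have hpN : 1 ≤ (p : ℝ) ^ N x := one_le_pow₀ (by exact_mod_cast h.pos)
      simp only [mul_one, Finset.sum_sub_distrib, kernel_sum, Finset.sum_const, nsmul_eq_mul,
        Finset.card_univ, ← Nat.card_eq_fintype_card, h.card_stabilizer, survival]
      have e1 : (Nat.card X : ℝ) * (1 / (p : ℝ) ^ N x * (1 / (Nat.card X : ℝ))) =
        1 / (p : ℝ) ^ N x := by field_simp
      have e2 : 1 / (p : ℝ) ^ N x * δ ≤ δ :=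
        mul_le_of_le_one_left hδ0 ((div_le_one (by positivity)).2 hpN)
      rw [e1]
      simp only [zero_add, pow_one, sub_sub_cancel, one_div, inv_pow, Nat.cast_zero, zero_mul]
      simp only [one_div] at e2
      linarith
    | succ t ih =>
      intro x
      have h1 := tvDist_succ_le (t + 1) _ δ h.tvDist_uniform_le ih x
      refine h1.trans ?_
      have hst := card_stabilizer_pos (G := G) x
      set c : ℝ := 1 / (Nat.card (MulAction.stabilizer G x) : ℝ) with hc
      have hc0 : 0 ≤ c := by positivity
      have hsum : ∑ y, (kernel G X x y - c * (1 / (Nat.card X : ℝ))) *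
          (survival p (t + 1) (N y) + ((t : ℝ) * ε + δ)) ≤
          Matrix.mulVec (kernel G X) (fun y => survival p (t + 1) (N y)) x +
            ((t : ℝ) * ε + δ) - c * ((t : ℝ) * ε + δ) := by
        rw [← kernel_mulVec_add_const]
        simp only [Matrix.mulVec, dotProduct, sub_mul, Finset.sum_sub_distrib]
        refine sub_le_sub_left ?_ _
        calc c * ((t : ℝ) * ε + δ)
            = ∑ y : X, c * (1 / (Nat.card X : ℝ)) * ((t : ℝ) * ε + δ) := by
              rw [Finset.sum_const, nsmul_eq_mul, Finset.card_univ, ← Nat.card_eq_fintype_card]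
              field_simp
          _ ≤ _ := by
              refine Finset.sum_le_sum fun y _ => mul_le_mul_of_nonneg_left ?_ (by positivity)
              linarith [survival_nonneg p (t + 1) (N y)]
      have h2 := h.kernel_survival_le (t + 1) x
      have h3 : 0 ≤ c * ((t : ℝ) * ε) := by have := h.eps_nonneg; positivity
      push_cast
      linarith
  refine ciSup_le fun x => (key t x).trans ?_
  have := survival_mono_right p (t + 1) (h.count_le x)
  have := h.eps_nonneg
  push_cast
  linarith

end NearlyPureDeath

/-! ### Double cosets of the group generated by `k` disjoint `p`-cycles -/

section Shift

variable {k p : ℕ}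

/-- Translation by `a i` of the `i`-th block of `Fin k × ZMod p`. The nonzero translations of a
single block are the powers of a `p`-cycle. -/
def shift (a : Fin k → ZMod p) : Equiv.Perm (Fin k × ZMod p) where
  toFun v := (v.1, v.2 + a v.1)
  invFun v := (v.1, v.2 - a v.1)
  left_inv v := by simp
  right_inv v := by simp

@[simp] theorem shift_apply (a : Fin k → ZMod p) (v : Fin k × ZMod p) :
    shift a v = (v.1, v.2 + a v.1) := rfl

theorem shift_add (a b : Fin k → ZMod p) : shift (a + b) = shift a * shift b := by
  ext v <;> simp [add_assoc, add_comm (a v.1)]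

theorem shift_injective : Function.Injective (shift : (Fin k → ZMod p) → _) := fun a b h => by
  funext i
  simpa using congrArg Prod.snd (Equiv.congr_fun h (i, 0))

/-- Block translations as a homomorphism. -/
def shiftHom (k p : ℕ) : Multiplicative (Fin k → ZMod p) →* Equiv.Perm (Fin k × ZMod p) where
  toFun a := shift a.toAdd
  map_one' := by ext v <;> simp
  map_mul' a b := by simp [shift_add]

/-- The group of block translations of `Fin k × ZMod p`, generated by `k` disjoint `p`-cycles. -/
def shiftGroup (k p : ℕ) : Subgroup (Equiv.Perm (Fin k × ZMod p)) := (shiftHom k p).range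

theorem mem_shiftGroup {σ : Equiv.Perm (Fin k × ZMod p)} :
    σ ∈ shiftGroup k p ↔ ∃ a, shift a = σ := Iff.rfl

theorem card_shiftGroup : Nat.card (shiftGroup k p) = p ^ k := by
  have h : Function.Injective (shiftHom k p) := fun a b h => shift_injective h
  rw [shiftGroup, ← Nat.card_congr (MonoidHom.ofInjective h).toEquiv,
    Nat.card_congr Multiplicative.toAdd, Nat.card_fun]
  simp

/-- The translation vector of a block translation. -/
def shiftVec (σ : Equiv.Perm (Fin k × ZMod p)) (i : Fin k) : ZMod p := (σ (i, 0)).2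

@[simp] theorem shiftVec_shift (a : Fin k → ZMod p) : shiftVec (shift a) = a := by
  funext i; simp [shiftVec]

theorem shift_shiftVec {σ : Equiv.Perm (Fin k × ZMod p)} (h : σ ∈ shiftGroup k p) :
    shift (shiftVec σ) = σ := by
  obtain ⟨a, rfl⟩ := mem_shiftGroup.1 h
  rw [shiftVec_shift]

open Classical in
/-- The blocks `i` such that `σ` maps some block affinely onto block `i`. For prime `p` these are
the blocks whose translations lie in `σ H σ⁻¹`, where `H` is the group of block translations. -/
noncomputable def affineBlocks (σ : Equiv.Perm (Fin k × ZMod p)) : Finset (Fin k) :=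
  Finset.univ.filter fun i => ∃ j y d, ∀ s, σ.symm (i, s) = (j, y + d * s)

theorem mem_affineBlocks {σ : Equiv.Perm (Fin k × ZMod p)} {i : Fin k} :
    i ∈ affineBlocks σ ↔ ∃ j y d, ∀ s, σ.symm (i, s) = (j, y + d * s) := by
  simp [affineBlocks]

end Shift

section Prime

variable {k p : ℕ} [hp : Fact p.Prime]

/-- `σ⁻¹` carries the orbit of a point of block `i` under `shift a` to an orbit of `shift b`, hence to
a single block, and intertwines the two translations. -/
theorem mem_affineBlocks_of_conj {σ : Equiv.Perm (Fin k × ZMod p)} {a b : Fin k → ZMod p}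
    (h : σ * shift b = shift a * σ) {i : Fin k} (hi : a i ≠ 0) : i ∈ affineBlocks σ := by
  have hs : ∀ v, σ.symm (shift a v) = shift b (σ.symm v) := fun v => by
    rw [Equiv.symm_apply_eq]
    simpa using (Equiv.congr_fun h (σ.symm v)).symm
  obtain ⟨⟨j, y⟩, hjy⟩ : ∃ w, σ.symm (i, 0) = w := ⟨_, rfl⟩
  have hn : ∀ n : ℕ, σ.symm (i, n * a i) = (j, y + n * b j) := by
    intro n
    induction n with
    | zero => simp [hjy]
    | succ n ih =>
      have := hs (i, n * a i)
      rw [ih] at this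
      simp only [shift_apply] at this
      push_cast
      rw [add_mul, one_mul, this, add_mul, one_mul, add_assoc]
  refine mem_affineBlocks.2 ⟨j, y, (a i)⁻¹ * b j, fun s => ?_⟩
  have := hn (s * (a i)⁻¹).val
  rw [ZMod.natCast_zmod_val, mul_assoc, inv_mul_cancel₀ hi, mul_one] at this
  rw [this]
  ring_nf

theorem exists_conj_single {σ : Equiv.Perm (Fin k × ZMod p)} {i : Fin k}
    (hi : i ∈ affineBlocks σ) (z : ZMod p) :
    ∃ b, σ * shift b = shift (Pi.single i z) * σ := by
  obtain ⟨j, y, d, h⟩ := mem_affineBlocks.1 hi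
  have hd : d ≠ 0 := by
    rintro rfl
    have := σ.symm.injective ((h 0).trans ((by simp : (j, y + 0 * 0) = (j, y + 0 * 1)).trans
      (h 1).symm))
    simp at this
  refine ⟨Pi.single j (d * z), ?_⟩
  ext1 w
  obtain ⟨⟨i', s⟩, rfl⟩ := σ.symm.surjective w
  rw [Equiv.Perm.mul_apply, Equiv.Perm.mul_apply, Equiv.apply_symm_apply, ← Equiv.eq_symm_apply]
  by_cases hii : i' = i
  · subst hii
    rw [h s]
    simp [h, mul_add, add_assoc]
  · have hj : (σ.symm (i', s)).1 ≠ j := by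
      intro hj
      -- `σ⁻¹` maps block `i` onto block `j`, so it maps no other point into block `j`.
      have h1 := h (((σ.symm (i', s)).2 - y) / d)
      rw [mul_div_cancel₀ _ hd, add_sub_cancel, ← hj, Prod.mk.eta] at h1
      exact hii (congrArg Prod.fst (σ.symm.injective h1)).symm
    simp [Pi.single_eq_of_ne hj, Pi.single_eq_of_ne hii]

/-- The stabilizer of `σ`: `shift a` lies in `σ H σ⁻¹`, for `H` the group of block translations,
exactly when it moves only affine blocks of `σ`. -/
theorem exists_conj_iff {σ : Equiv.Perm (Fin k × ZMod p)} {a : Fin k → ZMod p} :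
    (∃ b, σ * shift b = shift a * σ) ↔ ∀ i, a i ≠ 0 → i ∈ affineBlocks σ := by
  refine ⟨fun ⟨b, h⟩ i hi => mem_affineBlocks_of_conj h hi, fun h => ?_⟩
  rw [← Finset.univ_sum_single a]
  refine Finset.sum_induction _ (fun a => ∃ b, σ * shift b = shift a * σ) ?_ ?_ fun i _ => ?_
  · rintro a a' ⟨b, hb⟩ ⟨b', hb'⟩
    exact ⟨b + b', by rw [shift_add, shift_add, ← mul_assoc, hb, mul_assoc, hb', mul_assoc]⟩
  · exact ⟨0, by ext v <;> simp⟩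
  · by_cases hi : a i = 0
    · exact ⟨0, by rw [hi]; ext v <;> simp⟩
    · exact exists_conj_single (h i hi) _

theorem affineBlocks_one : affineBlocks (1 : Equiv.Perm (Fin k × ZMod p)) = Finset.univ := by
  ext i
  simp only [mem_affineBlocks, Finset.mem_univ, iff_true]
  exact ⟨i, 0, 1, fun s => by simp [Equiv.Perm.one_def]⟩

open Classical in
/-- The generating function of the number of nonzero coordinates of a vector supported on `I`. -/
theorem sum_pow_card_support (I : Finset (Fin k)) (u : ℝ) :
    ∑ a : Fin k → ZMod p with (∀ i, a i ≠ 0 → i ∈ I),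
      u ^ (Finset.univ.filter fun i => a i ≠ 0).card = (1 + ((p : ℝ) - 1) * u) ^ I.card := by
  have hset : (Finset.univ.filter fun a : Fin k → ZMod p => ∀ i, a i ≠ 0 → i ∈ I) =
      Fintype.piFinset fun i => if i ∈ I then Finset.univ else {0} := by
    ext a
    simp only [Finset.mem_filter, Finset.mem_univ, true_and, Fintype.mem_piFinset]
    refine forall_congr' fun i => ?_
    split_ifs with hi <;> simp [hi]
  have hterm : ∀ a : Fin k → ZMod p, u ^ (Finset.univ.filter fun i => a i ≠ 0).card =
      ∏ i, if a i ≠ 0 then u else 1 := fun a => by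
    rw [← Finset.prod_filter, Finset.prod_const]
  have hz : ∑ z : ZMod p, (if z ≠ 0 then u else 1) = 1 + ((p : ℝ) - 1) * u := by
    rw [← Finset.add_sum_erase _ _ (Finset.mem_univ (0 : ZMod p)),
      Finset.sum_congr rfl (g := fun _ => u) fun z hz => by simp [Finset.ne_of_mem_erase hz]]
    simp [Finset.card_erase_of_mem, ZMod.card, Nat.cast_sub hp.out.one_le]
  rw [hset, Finset.sum_congr rfl fun a _ => hterm a,
    ← Finset.prod_univ_sum (fun i => if i ∈ I then Finset.univ else {0})
      (fun _ z => if z ≠ 0 then u else (1 : ℝ))]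
  rw [Finset.prod_congr rfl (g := fun i => if i ∈ I then 1 + ((p : ℝ) - 1) * u else 1)]
  · rw [← Finset.prod_filter, Finset.prod_const]
    congr 2
    ext; simp
  · intro i _
    split_ifs
    · exact hz
    · simp

open Classical in
/-- Changing `τ` by a permutation of block `i` makes some block map affinely onto block `i` in at
most `p²` ways: the source block is determined by `τ`, and the affine map has two parameters. -/
theorem card_affine_le (τ : Equiv.Perm (Fin k × ZMod p)) (i : Fin k) :
    (Finset.univ.filter fun κ : Equiv.Perm (ZMod p) =>
      i ∈ affineBlocks (Equiv.Perm.prodExtendRight i κ * τ)).card ≤ p ^ 2 := by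
  have : Nonempty (Fin k) := ⟨i⟩
  have hS : ∀ κ : Equiv.Perm (ZMod p), i ∈ affineBlocks (Equiv.Perm.prodExtendRight i κ * τ) →
      ∃ j y d, ∀ s, τ.symm (i, κ.symm s) = (j, y + d * s) := by
    intro κ hκ
    obtain ⟨j, y, d, h⟩ := mem_affineBlocks.1 hκ
    refine ⟨j, y, d, fun s => ?_⟩
    rw [← h s, Equiv.eq_symm_apply, Equiv.Perm.mul_apply, Equiv.apply_symm_apply,
      Equiv.Perm.prodExtendRight_apply_eq, Equiv.apply_symm_apply]
  choose! j y d h using hS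
  have hj : ∀ κ, i ∈ affineBlocks (Equiv.Perm.prodExtendRight i κ * τ) →
      j κ = (τ.symm (i, 0)).1 := fun κ hκ => by
    have := h κ hκ (κ 0)
    rw [Equiv.symm_apply_apply] at this
    rw [this]
  have hcard : (Finset.univ : Finset (ZMod p × ZMod p)).card = p ^ 2 := by
    simp [ZMod.card, sq]
  rw [← hcard]
  refine Finset.card_le_card_of_injOn (fun κ => (y κ, d κ)) (fun _ _ => Finset.mem_univ _) ?_
  intro κ hκ κ' hκ' e
  replace hκ := (Finset.mem_filter.1 hκ).2
  replace hκ' := (Finset.mem_filter.1 hκ').2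
  simp only [Prod.mk.injEq] at e
  refine Equiv.symm_bijective.injective (Equiv.ext fun s => ?_)
  have := (h κ hκ s).trans (by rw [hj κ hκ, ← hj κ' hκ', e.1, e.2, ← h κ' hκ' s])
  exact congrArg Prod.snd (τ.symm.injective this)

open Classical in
/-- If `a` fixes block `i`, then few of the permutations conjugating `shift b` to `shift a` map a
block affinely onto block `i`: such permutations may be followed by any permutation of block `i`,
and at most `p²` of the `p!` results are affine there. -/
theorem card_affine_mul_factorial_le {a b : Fin k → ZMod p} {i : Fin k} (hi : a i = 0) :
    (Finset.univ.filter fun τ => τ * shift b = shift a * τ ∧ i ∈ affineBlocks τ).card *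
        p.factorial ≤
      (Finset.univ.filter fun τ => τ * shift b = shift a * τ).card * p ^ 2 := by
  have hcomm : ∀ κ : Equiv.Perm (ZMod p), Equiv.Perm.prodExtendRight i κ * shift a =
      shift a * Equiv.Perm.prodExtendRight i κ := fun κ => by
    ext1 ⟨i', s⟩
    by_cases h : i' = i
    · subst h; simp [Equiv.Perm.mul_apply, Equiv.Perm.prodExtendRight_apply_eq, hi]
    · simp [Equiv.Perm.mul_apply, Equiv.Perm.prodExtendRight_apply_ne _ h]
  have hmem : ∀ (κ : Equiv.Perm (ZMod p)) (τ : Equiv.Perm (Fin k × ZMod p)),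
      (Equiv.Perm.prodExtendRight i κ * τ) * shift b =
        shift a * (Equiv.Perm.prodExtendRight i κ * τ) ↔ τ * shift b = shift a * τ := by
    intro κ τ
    rw [← mul_assoc (shift a), ← hcomm, mul_assoc, mul_assoc, mul_right_inj]
  have hshift : ∀ κ : Equiv.Perm (ZMod p),
      (Finset.univ.filter fun τ => τ * shift b = shift a * τ ∧ i ∈ affineBlocks τ).card =
      (Finset.univ.filter fun τ => τ * shift b = shift a * τ ∧
        i ∈ affineBlocks (Equiv.Perm.prodExtendRight i κ * τ)).card := fun κ => by
    symm
    refine Finset.card_equiv (Equiv.mulLeft (Equiv.Perm.prodExtendRight i κ)) fun τ => ?_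
    simp only [Finset.mem_filter, Finset.mem_univ, true_and, Equiv.coe_mulLeft, hmem]
  calc _ = ∑ κ : Equiv.Perm (ZMod p),
        (Finset.univ.filter fun τ => τ * shift b = shift a * τ ∧
          i ∈ affineBlocks (Equiv.Perm.prodExtendRight i κ * τ)).card := by
        rw [Finset.sum_congr rfl fun κ _ => (hshift κ).symm, Finset.sum_const, smul_eq_mul,
          Finset.card_univ, Fintype.card_perm, ZMod.card, mul_comm]
    _ = ∑ τ with τ * shift b = shift a * τ, (Finset.univ.filter fun κ : Equiv.Perm (ZMod p) =>
          i ∈ affineBlocks (Equiv.Perm.prodExtendRight i κ * τ)).card := by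
        simp only [← Finset.filter_filter]
        simp only [Finset.card_filter]
        exact Finset.sum_comm
    _ ≤ ∑ τ with τ * shift b = shift a * τ, p ^ 2 :=
        Finset.sum_le_sum fun τ _ => card_affine_le τ i
    _ = _ := by rw [Finset.sum_const, smul_eq_mul]

theorem smul_eq_iff {S : Type*} [Group S] {H : Subgroup S} (g : (↥H × ↥H)ᵐᵒᵖ) (σ : S) :
    g • σ = σ ↔ σ * (g.unop.2 : S) = (g.unop.1 : S) * σ := by
  change (g.unop.1 : S)⁻¹ * σ * (g.unop.2 : S) = σ ↔ _
  rw [mul_assoc, inv_mul_eq_iff_eq_mul]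

open Classical in
/-- The Burnside process on the double cosets of the block translations, the living individuals
being the affine blocks. -/
theorem nearlyPureDeath_shiftGroup (k p : ℕ) [hp : Fact p.Prime]
    [Fintype (↥(shiftGroup k p) × ↥(shiftGroup k p))ᵐᵒᵖ] :
    NearlyPureDeath (↥(shiftGroup k p) × ↥(shiftGroup k p))ᵐᵒᵖ (Equiv.Perm (Fin k × ZMod p)) p k
      (k * p ^ 2 / p.factorial) (fun σ => (affineBlocks σ).card)
      (fun g => (Finset.univ.filter fun i => shiftVec (g.unop.1 : Equiv.Perm (Fin k × ZMod p)) i ≠ 0).card) where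
  pos := hp.out.pos
  eps_nonneg := by positivity
  count_le σ := (Finset.card_le_univ _).trans (by simp)
  exists_count_eq := ⟨1, by simp [affineBlocks_one]⟩
  le_count g σ h := by
    rw [smul_eq_iff, ← shift_shiftVec g.unop.1.2, ← shift_shiftVec g.unop.2.2] at h
    refine Finset.card_le_card fun i hi => ?_
    exact mem_affineBlocks_of_conj h (Finset.mem_filter.1 hi).2
  sum_pow σ u := by
    rw [← sum_pow_card_support]
    refine Finset.sum_bij (fun g _ => shiftVec (g.unop.1 : Equiv.Perm (Fin k × ZMod p))) ?_ ?_ ?_ ?_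
    · intro g hg
      have h : g • σ = σ := by simpa using hg
      rw [smul_eq_iff, ← shift_shiftVec g.unop.1.2, ← shift_shiftVec g.unop.2.2] at h
      exact Finset.mem_filter.2 ⟨Finset.mem_univ _, exists_conj_iff.1 ⟨_, h⟩⟩
    · intro g hg g' hg' e
      have h : g • σ = σ := by simpa using hg
      have h' : g' • σ = σ := by simpa using hg'
      rw [smul_eq_iff] at h h'
      have e1 : (g.unop.1 : Equiv.Perm (Fin k × ZMod p)) = g'.unop.1 := by
        rw [← shift_shiftVec g.unop.1.2, e, shift_shiftVec g'.unop.1.2]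
      rw [← e1, ← h] at h'
      exact MulOpposite.unop_injective
        (Prod.ext (Subtype.ext e1) (Subtype.ext (mul_left_cancel h').symm))
    · intro a ha
      obtain ⟨b, hb⟩ := exists_conj_iff.2 (Finset.mem_filter.1 ha).2
      refine ⟨MulOpposite.op (⟨shift a, a, rfl⟩, ⟨shift b, b, rfl⟩), ?_, ?_⟩
      · simpa using (smul_eq_iff _ _).2 hb
      · exact shiftVec_shift a
    · intro g _
      rfl
  card_le g := by
    obtain ⟨a, ha⟩ := mem_shiftGroup.1 g.unop.1.2
    obtain ⟨b, hb⟩ := mem_shiftGroup.1 g.unop.2.2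
    simp only [smul_eq_iff, ← ha, ← hb, shiftVec_shift]
    have hsub : (Finset.univ.filter fun τ : Equiv.Perm (Fin k × ZMod p) =>
        τ * shift b = shift a * τ ∧ (affineBlocks τ).card ≠
          (Finset.univ.filter fun i => a i ≠ 0).card) ⊆
        (Finset.univ.filter fun i => a i = 0).biUnion fun i =>
          Finset.univ.filter fun τ => τ * shift b = shift a * τ ∧ i ∈ affineBlocks τ := by
      intro τ hτ
      obtain ⟨h1, h2⟩ := (Finset.mem_filter.1 hτ).2
      have hsupp : (Finset.univ.filter fun i => a i ≠ 0) ⊆ affineBlocks τ := fun i hi =>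
        mem_affineBlocks_of_conj h1 (Finset.mem_filter.1 hi).2
      obtain ⟨i, hi, hi'⟩ := Finset.exists_of_ssubset
        (hsupp.ssubset_of_ne fun e => h2 (by rw [e]))
      simp only [Finset.mem_filter, Finset.mem_univ, true_and, not_not] at hi'
      simp only [Finset.mem_biUnion, Finset.mem_filter, Finset.mem_univ, true_and]
      exact ⟨i, hi', h1, hi⟩
    set F := Finset.univ.filter fun τ : Equiv.Perm (Fin k × ZMod p) => τ * shift b = shift a * τ
      with hF
    have hone : ∀ i, a i = 0 → ((Finset.univ.filter fun τ : Equiv.Perm (Fin k × ZMod p) =>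
        τ * shift b = shift a * τ ∧ i ∈ affineBlocks τ).card : ℝ) ≤
          F.card * p ^ 2 / p.factorial := fun i hi => by
      rw [le_div_iff₀ (by positivity)]
      have := card_affine_mul_factorial_le (b := b) hi
      exact_mod_cast this
    calc _ ≤ (((Finset.univ.filter fun i => a i = 0).biUnion fun i =>
          Finset.univ.filter fun τ => τ * shift b = shift a * τ ∧ i ∈ affineBlocks τ).card : ℝ) :=
          by exact_mod_cast Finset.card_le_card hsub
      _ ≤ ∑ i with a i = 0, ((Finset.univ.filter fun τ : Equiv.Perm (Fin k × ZMod p) =>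
            τ * shift b = shift a * τ ∧ i ∈ affineBlocks τ).card : ℝ) := by
          exact_mod_cast Finset.card_biUnion_le
      _ ≤ ∑ i with a i = 0, (F.card * p ^ 2 / p.factorial : ℝ) :=
          Finset.sum_le_sum fun i hi => hone i (Finset.mem_filter.1 hi).2
      _ ≤ k * (F.card * p ^ 2 / p.factorial : ℝ) := by
          rw [Finset.sum_const, nsmul_eq_mul]
          refine mul_le_mul_of_nonneg_right ?_ (by positivity)
          exact_mod_cast (Finset.card_le_univ _).trans (by simp)
      _ = _ := by ring

end Prime

/-! ### Sylow subgroups of the symmetric group -/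

theorem factorization_factorial_mul {p k : ℕ} (hp : p.Prime) (hk : k < p) :
    (p * k).factorial.factorization p = k := by
  have h := hp.emultiplicity_factorial_mul (n := k)
  have h0 : emultiplicity p k.factorial = 0 := by
    rw [emultiplicity_eq_zero, hp.dvd_factorial]
    omega
  rw [h0, zero_add] at h
  rw [Nat.factorization_def _ hp, ← Nat.cast_inj (R := ℕ∞), ← h]
  have : Fact p.Prime := ⟨hp⟩
  exact padicValNat_eq_emultiplicity (Nat.factorial_ne_zero _)

theorem exists_mulEquiv_map_eq_shiftGroup {p k : ℕ} (hp : p.Prime) (hk : k < p)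
    (H : Sylow p (Equiv.Perm (Fin (p * k)))) :
    ∃ φ : Equiv.Perm (Fin (p * k)) ≃* Equiv.Perm (Fin k × ZMod p),
      (H : Subgroup (Equiv.Perm (Fin (p * k)))).map φ.toMonoidHom = shiftGroup k p := by
  have : Fact p.Prime := ⟨hp⟩
  have e : Fin (p * k) ≃ Fin k × ZMod p :=
    Fintype.equivOfCardEq (by simp [ZMod.card, mul_comm])
  have hcard : (Nat.card (Equiv.Perm (Fin k × ZMod p))).factorization p = k := by
    rw [Nat.card_perm, Nat.card_congr e.symm, Nat.card_fin, factorization_factorial_mul hp hk]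
  let P : Sylow p (Equiv.Perm (Fin k × ZMod p)) :=
    Sylow.ofCard (shiftGroup k p) (by rw [hcard, card_shiftGroup])
  let Q : Sylow p (Equiv.Perm (Fin k × ZMod p)) :=
    H.mapSurjective (f := e.permCongrHom.toMonoidHom) e.permCongrHom.surjective
  obtain ⟨g, hg⟩ := MulAction.exists_smul_eq (Equiv.Perm (Fin k × ZMod p)) Q P
  refine ⟨e.permCongrHom.trans (MulAut.conj g), ?_⟩
  have h2 : ((g • Q : Sylow p _) : Subgroup (Equiv.Perm (Fin k × ZMod p))) = shiftGroup k p := by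
    rw [hg]; rfl
  rw [← h2]
  change Subgroup.map ((MulAut.conj g).toMonoidHom.comp e.permCongrHom.toMonoidHom) _ = _
  rw [← Subgroup.map_map]
  rfl

/-- Isomorphic pairs of a group and a subgroup have isomorphic double coset actions. -/
theorem worstDist_doubleCoset_congr {S S' : Type*} [Group S] [Group S'] [Fintype S] [Fintype S']
    (φ : S ≃* S') (H : Subgroup S) (H' : Subgroup S') (h : H.map φ.toMonoidHom = H')
    [Fintype (↥H × ↥H)ᵐᵒᵖ] [Fintype (↥H' × ↥H')ᵐᵒᵖ] (t : ℕ) :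
    worstDist (↥H × ↥H)ᵐᵒᵖ S t = worstDist (↥H' × ↥H')ᵐᵒᵖ S' t := by
  let ψ : ↥H ≃* ↥H' := (φ.subgroupMap H).trans (MulEquiv.subgroupCongr h)
  refine worstDist_congr (MulEquiv.op (ψ.prodCongr ψ)) φ.toEquiv (fun g σ => ?_) t
  change φ ((g.unop.1 : S)⁻¹ * σ * (g.unop.2 : S)) =
    (φ (g.unop.1 : S))⁻¹ * φ σ * φ (g.unop.2 : S)
  rw [map_mul, map_mul, map_inv]

/-- The distance of the Sylow--Burnside process is that of the pure death process, up to the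
probability of an accidental match within the first `t` steps and the stationary mass of the
permutations with an affine block, which is estimated by running the stationary process for `s`
steps. -/
theorem sylowDist_bounds {p k : ℕ} (hp : p.Prime) (hk0 : 0 < k) (hk : k < p)
    (H : Sylow p (Equiv.Perm (Fin (p * k)))) (s : ℕ) (t : ℝ) :
    survival p ⌊t⌋₊ k - (survival p s k + s * (k * p ^ 2 / p.factorial)) ≤ sylowDist H t ∧
    sylowDist H t ≤ survival p ⌊t⌋₊ k + ⌊t⌋₊ * (k * p ^ 2 / p.factorial) +
      (survival p s k + s * (k * p ^ 2 / p.factorial)) := by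
  classical
  have : Fact p.Prime := ⟨hp⟩
  obtain ⟨φ, hφ⟩ := exists_mulEquiv_map_eq_shiftGroup hp hk H
  have h := nearlyPureDeath_shiftGroup k p
  rw [sylowDist, worstDist_doubleCoset_congr φ _ _ hφ]
  have h1 := h.survival_le_worstDist ⌊t⌋₊
  have h2 := h.worstDist_le hk0 ⌊t⌋₊
  have h3 := h.stationary_alive_le s
  constructor <;> linarith

theorem sylowDist_nonneg {p n : ℕ} (H : Sylow p (Equiv.Perm (Fin n))) (t : ℝ) :
    0 ≤ sylowDist H t := by
  classical exact worstDist_nonneg _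

theorem sylowDist_le_one {p n : ℕ} (H : Sylow p (Equiv.Perm (Fin n))) (t : ℝ) :
    sylowDist H t ≤ 1 := by
  classical exact worstDist_le_one _

theorem sylowDist_antitone {p n : ℕ} (H : Sylow p (Equiv.Perm (Fin n))) :
    Antitone (sylowDist H) := by
  classical exact fun _ _ h => worstDist_antitone (Nat.floor_le_floor h)

/-! ### Asymptotics -/

/-- A bound for the stationary mass of the permutations with an affine block: after `p ^ 2` steps
from any starting point, it bounds the probability that such a block has survived (first summand)
or has been matched by accident (second summand). -/
noncomputable def matchBound (p : ℕ) : ℝ :=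
  (p : ℝ) * Real.exp (-p) + (p : ℝ) ^ 5 / p.factorial

theorem tendsto_pow_div_factorial (j : ℕ) :
    Tendsto (fun n : ℕ => (n : ℝ) ^ j / n.factorial) atTop (𝓝 0) := by
  have h1 := tendsto_pow_const_div_const_pow_of_one_lt j (r := (2 : ℝ)) (by norm_num)
  have h2 := FloorSemiring.tendsto_pow_div_factorial_atTop (2 : ℝ)
  have h := h1.mul h2
  rw [mul_zero] at h
  exact h.congr fun n => by field_simp

theorem tendsto_matchBound : Tendsto matchBound atTop (𝓝 0) := by
  have h1 := (Real.tendsto_pow_mul_exp_neg_atTop_nhds_zero 1).comp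
    (tendsto_natCast_atTop_atTop (R := ℝ))
  have h := h1.add (tendsto_pow_div_factorial 5)
  rw [add_zero] at h
  exact h.congr fun n => by simp [matchBound]

theorem survival_add_le_matchBound {p k : ℕ} (hp : 0 < p) (hk : k ≤ p) :
    survival p (p ^ 2) k + ((p ^ 2 : ℕ) : ℝ) * (k * p ^ 2 / p.factorial) ≤ matchBound p := by
  have hp' : (0 : ℝ) < p := by exact_mod_cast hp
  have hk' : (k : ℝ) ≤ p := by exact_mod_cast hk
  have h1 : (1 - 1 / (p : ℝ)) ^ (p ^ 2) ≤ Real.exp (-p) := by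
    have h := Real.one_sub_le_exp_neg (1 / (p : ℝ))
    refine (pow_le_pow_left₀ (one_sub_inv_mem_Icc p).1 h _).trans_eq ?_
    rw [← Real.exp_nat_mul]
    congr 1
    push_cast
    field_simp
  refine add_le_add ((survival_le_mul _ _ _).trans ?_) ?_
  · exact mul_le_mul hk' h1 (pow_nonneg (one_sub_inv_mem_Icc p).1 _) hp'.le
  · rw [← mul_div_assoc]
    refine div_le_div_of_nonneg_right ?_ (by positivity)
    push_cast
    calc (p : ℝ) ^ 2 * (k * p ^ 2) ≤ (p : ℝ) ^ 2 * (p * p ^ 2) := by gcongr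
      _ = _ := by ring

theorem abs_sylowDist_sub_survival_le {p k : ℕ} (hp : p.Prime) (hk0 : 0 < k) (hk : k < p)
    (H : Sylow p (Equiv.Perm (Fin (p * k)))) {t C : ℝ} (hC : 0 ≤ C) (ht : t ≤ C * p ^ 2) :
    |sylowDist H t - survival p ⌊t⌋₊ k| ≤ C * (p ^ 5 / p.factorial) + matchBound p := by
  obtain ⟨h1, h2⟩ := sylowDist_bounds hp hk0 hk H (p ^ 2) t
  have h3 := survival_add_le_matchBound hp.pos hk.le
  have hfl : (⌊t⌋₊ : ℝ) ≤ C * p ^ 2 := by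
    rcases le_total 0 t with h | h
    · exact (Nat.floor_le h).trans ht
    · rw [Nat.floor_of_nonpos h, Nat.cast_zero]; positivity
  have hk' : (k : ℝ) ≤ p := by exact_mod_cast hk.le
  have h4 : (⌊t⌋₊ : ℝ) * (k * p ^ 2 / p.factorial) ≤ C * (p ^ 5 / p.factorial) := by
    calc (⌊t⌋₊ : ℝ) * (k * p ^ 2 / p.factorial)
        ≤ (C * p ^ 2) * (p * p ^ 2 / p.factorial) := by gcongr
      _ = _ := by ring
  have h5 : 0 ≤ C * ((p : ℝ) ^ 5 / p.factorial) := by positivity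
  rw [abs_le]
  constructor <;> linarith

section Limits

variable {p : ℕ → ℕ} (hp : ∀ m, (p m).Prime) (hp_lim : Tendsto p atTop atTop)
  {ℓ : ℕ → ℝ} (hℓ : ∀ m, Real.exp (ℓ m) ≤ p m)

include hp hp_lim hℓ in
theorem tendsto_sylowDist_sub_survival {k : ℕ → ℕ} (hk_pos : ∀ m, 0 < k m)
    (hk_lt : ∀ m, k m < p m) (H : ∀ m, Sylow (p m) (Equiv.Perm (Fin (p m * k m)))) (c : ℝ) :
    Tendsto (fun m => sylowDist (H m) ((p m : ℝ) * ℓ m + c * p m) -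
      survival (p m) ⌊(p m : ℝ) * ℓ m + c * p m⌋₊ (k m)) atTop (𝓝 0) := by
  have hlim : Tendsto (fun m => (1 + |c|) * ((p m : ℝ) ^ 5 / (p m).factorial) +
      matchBound (p m)) atTop (𝓝 0) := by
    have h := ((tendsto_pow_div_factorial 5).const_mul (1 + |c|)).add tendsto_matchBound
    rw [mul_zero, add_zero] at h
    exact h.comp hp_lim
  refine squeeze_zero_norm (fun m => ?_) hlim
  rw [Real.norm_eq_abs]
  refine abs_sylowDist_sub_survival_le (hp m) (hk_pos m) (hk_lt m) (H m) (by positivity) ?_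
  have hp1 : (1 : ℝ) ≤ p m := by exact_mod_cast (hp m).one_le
  have h1 : ℓ m ≤ p m := by linarith [Real.add_one_le_exp (ℓ m), hℓ m]
  have h2 : c ≤ |c| * p m := (le_abs_self c).trans (le_mul_of_one_le_right (abs_nonneg c) hp1)
  nlinarith

include hp hp_lim hℓ in
/-- After `p (ℓ + c)` steps an individual is alive with probability about `exp (-(ℓ + c))`. The
growth condition on `ℓ` keeps the second-order term `p * ℓ / p ^ 2` of the logarithm negligible. -/
theorem tendsto_exp_mul_pow_floor (c : ℝ)
    (hT : ∀ᶠ m in atTop, 0 ≤ (p m : ℝ) * ℓ m + c * p m) :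
    Tendsto (fun m => Real.exp (ℓ m) * (1 - 1 / (p m : ℝ)) ^ ⌊(p m : ℝ) * ℓ m + c * p m⌋₊)
      atTop (𝓝 (Real.exp (-c))) := by
  have hpR : Tendsto (fun m => (p m : ℝ)) atTop atTop := tendsto_natCast_atTop_atTop.comp hp_lim
  have hinv : Tendsto (fun m => (1 : ℝ) / p m) atTop (𝓝 0) :=
    tendsto_const_nhds.div_atTop hpR
  have hlog : Tendsto (fun m => (Real.log (p m) + |c|) * (2 / (p m : ℝ))) atTop (𝓝 0) := by
    have h1 : Tendsto (fun m => Real.log (p m) / (p m : ℝ)) atTop (𝓝 0) :=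
      (Real.isLittleO_log_id_atTop.tendsto_div_nhds_zero).comp hpR
    have h := (h1.add (hinv.const_mul |c|)).const_mul 2
    rw [mul_zero, add_zero, mul_zero] at h
    exact h.congr fun m => by ring
  have key : Tendsto (fun m => ℓ m + ⌊(p m : ℝ) * ℓ m + c * p m⌋₊ *
      Real.log (1 - 1 / (p m : ℝ))) atTop (𝓝 (-c)) := by
    have hlow := hlog.const_sub (-c)
    have hup := hinv.const_add (-c)
    rw [sub_zero] at hlow
    rw [add_zero] at hup
    refine tendsto_of_tendsto_of_tendsto_of_le_of_le' hlow hup ?_ ?_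
    all_goals
      filter_upwards [hT] with m hTm
      have hp2 : (2 : ℝ) ≤ p m := by exact_mod_cast (hp m).two_le
      have hp0 : (0 : ℝ) < p m := by linarith
      have hq : 0 < 1 - 1 / (p m : ℝ) := by
        rw [sub_pos, div_lt_one hp0]; linarith
    · have h1 := Real.one_sub_inv_le_log_of_pos hq
      have e1 : 1 - (1 - 1 / (p m : ℝ))⁻¹ = -(1 / p m + 1 / (p m * (p m - 1))) := by
        have : (p m : ℝ) - 1 ≠ 0 := by linarith
        field_simp
        ring
      rw [e1] at h1
      have h2 := Nat.floor_le hTm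
      have hnn : 0 ≤ 1 / (p m : ℝ) + 1 / (p m * (p m - 1)) := by
        have : (0 : ℝ) < p m - 1 := by linarith
        positivity
      have h3 : (⌊(p m : ℝ) * ℓ m + c * p m⌋₊ : ℝ) * (1 / (p m : ℝ) + 1 / (p m * (p m - 1))) ≤
          ((p m : ℝ) * ℓ m + c * p m) * (1 / (p m : ℝ) + 1 / (p m * (p m - 1))) :=
        mul_le_mul_of_nonneg_right h2 hnn
      have e2 : ((p m : ℝ) * ℓ m + c * p m) * (1 / (p m : ℝ) + 1 / (p m * (p m - 1))) =
          ℓ m + c + (ℓ m + c) * (1 / (p m - 1)) := by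
        have : (p m : ℝ) - 1 ≠ 0 := by linarith
        field_simp
      have hl : ℓ m ≤ Real.log (p m) := (Real.le_log_iff_exp_le hp0).2 (hℓ m)
      have hlc : 0 ≤ ℓ m + c := by
        have : 0 ≤ (p m : ℝ) * (ℓ m + c) := by linarith
        exact nonneg_of_mul_nonneg_right this hp0
      have h4 : (ℓ m + c) * (1 / ((p m : ℝ) - 1)) ≤ (Real.log (p m) + |c|) * (2 / (p m : ℝ)) := by
        refine mul_le_mul (by linarith [le_abs_self c]) ?_ ?_ (by linarith [le_abs_self c])
        · rw [div_le_div_iff₀ (by linarith) hp0]; linarith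
        · exact one_div_nonneg.2 (by linarith)
      have h5 := mul_le_mul_of_nonneg_left h1
        (Nat.cast_nonneg (α := ℝ) ⌊(p m : ℝ) * ℓ m + c * p m⌋₊)
      linarith
    · have h1 := Real.log_le_sub_one_of_pos hq
      have h2 := (Nat.lt_floor_add_one ((p m : ℝ) * ℓ m + c * p m)).le
      have h3 := mul_le_mul_of_nonneg_left h1
        (Nat.cast_nonneg (α := ℝ) ⌊(p m : ℝ) * ℓ m + c * p m⌋₊)
      have h4 : ((p m : ℝ) * ℓ m + c * p m) * (1 / (p m : ℝ)) ≤
          (⌊(p m : ℝ) * ℓ m + c * p m⌋₊ + 1) * (1 / (p m : ℝ)) :=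
        mul_le_mul_of_nonneg_right h2 (by positivity)
      have e2 : ((p m : ℝ) * ℓ m + c * p m) * (1 / (p m : ℝ)) = ℓ m + c := by field_simp
      linarith
  refine ((Real.continuous_exp.tendsto _).comp key).congr fun m => ?_
  have hp2 : (2 : ℝ) ≤ p m := by exact_mod_cast (hp m).two_le
  have hq : 0 < 1 - 1 / (p m : ℝ) := by
    rw [sub_pos, div_lt_one (by linarith)]; linarith
  rw [Function.comp_apply, Real.exp_add, Real.exp_nat_mul, Real.exp_log hq]

end Limits

theorem tendsto_one_sub_pow_exp {k : ℕ → ℕ} {a : ℕ → ℝ} {x : ℝ} (hk : Tendsto k atTop atTop)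
    (ha : Tendsto (fun m => (k m : ℝ) * a m) atTop (𝓝 x)) :
    Tendsto (fun m => (1 - a m) ^ k m) atTop (𝓝 (Real.exp (-x))) := by
  have hkR : Tendsto (fun m => (k m : ℝ)) atTop atTop := tendsto_natCast_atTop_atTop.comp hk
  have ha0 : Tendsto a atTop (𝓝 0) := by
    refine (ha.div_atTop hkR).congr' ?_
    filter_upwards [hkR.eventually_gt_atTop 0] with m hm
    field_simp
  have h1 : Tendsto (fun m => 1 - a m) atTop (𝓝 1) := by simpa using ha0.const_sub 1
  have hpos : ∀ᶠ m in atTop, 0 < 1 - a m := h1.eventually_const_lt one_pos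
  have key : Tendsto (fun m => (k m : ℝ) * Real.log (1 - a m)) atTop (𝓝 (-x)) := by
    have hlow := (ha.div h1 one_ne_zero).neg
    rw [div_one] at hlow
    refine tendsto_of_tendsto_of_tendsto_of_le_of_le' hlow ha.neg ?_ ?_
    · filter_upwards [hpos] with m hm
      have h := mul_le_mul_of_nonneg_left (Real.one_sub_inv_le_log_of_pos hm)
        (Nat.cast_nonneg (α := ℝ) (k m))
      refine le_trans (le_of_eq ?_) h
      simp only [Pi.div_apply]
      field_simp
      ring
    · filter_upwards [hpos] with m hm
      have h := mul_le_mul_of_nonneg_left (Real.log_le_sub_one_of_pos hm)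
        (Nat.cast_nonneg (α := ℝ) (k m))
      linarith
  refine ((Real.continuous_exp.tendsto _).comp key).congr' ?_
  filter_upwards [hpos] with m hm
  rw [Function.comp_apply, Real.exp_nat_mul, Real.exp_log hm]

/-! ### Cutoff from the limit profile -/

section Cutoff

variable {d : ℕ → ℝ → ℝ} {p k : ℕ → ℕ}

/-- A profile at the scale `p` with values strictly between `0` and `1` excludes cutoff: the times
`t` would have to be of larger order than `p`, but then `d (t / 2)` would stay away from `1`. -/
theorem not_hasCutoffAt_of_profile (hd : ∀ m, Antitone (d m)) {L : ℝ → ℝ}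
    (hlim : ∀ c, 0 ≤ c → Tendsto (fun m => d m (c * p m)) atTop (𝓝 (L c)))
    (h3 : 0 < L 3) (h1 : L 1 < 1) : ¬ ∃ t, HasCutoffAt d t := by
  rintro ⟨t, hup, hlow⟩
  have hup := hup (1 / 2) (by norm_num)
  have hlow := hlow (1 / 2) (by norm_num) (by norm_num)
  -- Smallness at `(3 / 2) * t` against the profile at `3 * p` forces `2 * p ≤ t`, and then the
  -- distance at `t / 2` is at most that at `p`.
  have hlt := hup.eventually_lt (hlim 3 (by norm_num)) h3
  refine absurd (le_of_tendsto_of_tendsto hlow (hlim 1 zero_le_one) ?_) (not_le.2 h1)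
  filter_upwards [hlt] with m hm
  refine hd m ?_
  by_contra! hcon
  exact absurd (hd m (by linarith : (1 + 1 / 2) * t m ≤ 3 * p m)) (not_le.2 hm)

theorem tendsto_gumbel_atTop :
    Tendsto (fun c : ℝ => 1 - Real.exp (-Real.exp (-c))) atTop (𝓝 0) := by
  have h := ((Real.continuous_exp.tendsto _).comp
    (Real.tendsto_exp_neg_atTop_nhds_zero).neg).const_sub 1
  simpa using h

theorem tendsto_gumbel_atBot :
    Tendsto (fun c : ℝ => 1 - Real.exp (-Real.exp (-c))) atBot (𝓝 1) := by
  have h := (Real.tendsto_exp_atBot.comp (tendsto_neg_atTop_atBot.comp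
    (Real.tendsto_exp_atTop.comp tendsto_neg_atBot_atTop))).const_sub 1
  simpa using h

variable (hk : Tendsto k atTop atTop)
  (hlim : ∀ c : ℝ, Tendsto (fun m => d m ((p m : ℝ) * Real.log (k m) + c * p m)) atTop
    (𝓝 (1 - Real.exp (-Real.exp (-c)))))

include hk in
theorem tendsto_log_natCast : Tendsto (fun m => Real.log (k m)) atTop atTop :=
  Real.tendsto_log_atTop.comp (tendsto_natCast_atTop_atTop.comp hk)

include hk hlim in
theorem hasCutoffAt_of_profile (hd : ∀ m, Antitone (d m)) (h0 : ∀ m t, 0 ≤ d m t)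
    (h1 : ∀ m t, d m t ≤ 1) : HasCutoffAt d fun m => (p m : ℝ) * Real.log (k m) := by
  constructor
  · intro ε hε
    refine tendsto_order.2 ⟨fun a ha => Eventually.of_forall fun m => ha.trans_le (h0 m _),
      fun a ha => ?_⟩
    obtain ⟨c, hc⟩ := (tendsto_gumbel_atTop.eventually_lt_const ha).exists
    filter_upwards [(hlim c).eventually_lt_const hc,
      ((tendsto_log_natCast hk).const_mul_atTop hε).eventually_ge_atTop c] with m hm hm'
    refine (hd m ?_).trans_lt hm
    nlinarith [Nat.cast_nonneg (α := ℝ) (p m)]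
  · intro ε hε _
    refine tendsto_order.2 ⟨fun a ha => ?_,
      fun a ha => Eventually.of_forall fun m => (h1 m _).trans_lt ha⟩
    obtain ⟨c, hc⟩ := (tendsto_gumbel_atBot.eventually_const_lt ha).exists
    filter_upwards [(hlim c).eventually_const_lt hc,
      ((tendsto_log_natCast hk).const_mul_atTop hε).eventually_ge_atTop (-c)] with m hm hm'
    refine hm.trans_le (hd m ?_)
    nlinarith [Nat.cast_nonneg (α := ℝ) (p m)]

include hk hlim in
theorem hasCutoffWindow_of_profile :
    HasCutoffWindow d (fun m => (p m : ℝ) * Real.log (k m)) fun m => (p m : ℝ) := by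
  refine ⟨?_, ?_, ?_⟩
  · have h : (fun _ : ℕ => (1 : ℝ)) =o[atTop] fun m => Real.log (k m) :=
      isLittleO_const_left.2 (Or.inr (tendsto_norm_atTop_atTop.comp (tendsto_log_natCast hk)))
    simpa using (isBigO_refl (fun m => (p m : ℝ)) atTop).mul_isLittleO h
  · simpa only [(hlim _).limsup_eq] using tendsto_gumbel_atTop
  · simpa only [(hlim _).liminf_eq] using tendsto_gumbel_atBot

end Cutoff

end Burnside

open Burnside in
theorem mainTheorem1 (p k : ℕ → ℕ) (hp : ∀ m, (p m).Prime) (hp_lim : Tendsto p atTop atTop)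
    (hk_pos : ∀ m, 0 < k m) (hk_lt : ∀ m, k m < p m)
    (H : ∀ m, Sylow (p m) (Equiv.Perm (Fin (p m * k m)))) :
    (∀ K : ℕ, (∀ᶠ m in atTop, k m = K) →
      (∀ c : ℝ, 0 ≤ c →
        Tendsto (fun m => Burnside.sylowDist (H m) (c * (p m : ℝ))) atTop
          (𝓝 (1 - (1 - Real.exp (-c)) ^ K))) ∧
      ¬ ∃ t : ℕ → ℝ, Burnside.HasCutoffAt (fun m => Burnside.sylowDist (H m)) t) ∧
    (Tendsto k atTop atTop →
      (∀ c : ℝ,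
        Tendsto
          (fun m => Burnside.sylowDist (H m) ((p m : ℝ) * Real.log (k m : ℝ) + c * (p m : ℝ)))
          atTop (𝓝 (1 - Real.exp (-Real.exp (-c))))) ∧
      Burnside.HasCutoffAt (fun m => Burnside.sylowDist (H m))
        (fun m => (p m : ℝ) * Real.log (k m : ℝ)) ∧
      Burnside.HasCutoffWindow (fun m => Burnside.sylowDist (H m))
        (fun m => (p m : ℝ) * Real.log (k m : ℝ)) (fun m => (p m : ℝ))) := by
  constructor
  · intro K hK
    have hlim : ∀ c : ℝ, 0 ≤ c → Tendsto (fun m => sylowDist (H m) (c * (p m : ℝ))) atTop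
        (𝓝 (1 - (1 - Real.exp (-c)) ^ K)) := by
      intro c hc
      have hℓ : ∀ m, Real.exp 0 ≤ p m := fun m => by
        rw [Real.exp_zero]; exact_mod_cast (hp m).one_le
      have h1 := tendsto_sylowDist_sub_survival hp hp_lim (ℓ := fun _ => 0) hℓ hk_pos hk_lt H c
      have h2 := tendsto_exp_mul_pow_floor hp hp_lim (ℓ := fun _ => 0) hℓ c
        (Eventually.of_forall fun m => by positivity)
      simp only [mul_zero, zero_add, Real.exp_zero, one_mul] at h1 h2
      have h3 := h1.add (((h2.const_sub 1).pow K).const_sub 1)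
      rw [zero_add] at h3
      refine h3.congr' ?_
      filter_upwards [hK] with m hm
      rw [survival, ← hm, sub_add_cancel]
    have hK0 : K ≠ 0 := by
      obtain ⟨m, hm⟩ := hK.exists
      exact hm ▸ (hk_pos m).ne'
    refine ⟨hlim, not_hasCutoffAt_of_profile (p := p) (fun m => sylowDist_antitone (H m)) hlim
      ?_ ?_⟩
    · have h1 : Real.exp (-3) < 1 := by rw [Real.exp_lt_one_iff]; norm_num
      exact sub_pos.2 (pow_lt_one₀ (by linarith) (by linarith [Real.exp_pos (-3)]) hK0)
    · have h1 : Real.exp (-1) < 1 := by rw [Real.exp_lt_one_iff]; norm_num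
      exact sub_lt_self _ (pow_pos (by linarith) K)
  · intro hk
    have hlim : ∀ c : ℝ, Tendsto (fun m => sylowDist (H m)
        ((p m : ℝ) * Real.log (k m : ℝ) + c * (p m : ℝ))) atTop
        (𝓝 (1 - Real.exp (-Real.exp (-c)))) := by
      intro c
      have hexp : ∀ m, Real.exp (Real.log (k m)) = k m := fun m =>
        Real.exp_log (by exact_mod_cast hk_pos m)
      have hℓ : ∀ m, Real.exp (Real.log (k m)) ≤ p m := fun m => by
        rw [hexp]; exact_mod_cast (hk_lt m).le
      have h1 := tendsto_sylowDist_sub_survival hp hp_lim hℓ hk_pos hk_lt H c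
      have h2 := tendsto_exp_mul_pow_floor hp hp_lim hℓ c (by
        filter_upwards [(tendsto_log_natCast hk).eventually_ge_atTop (-c)] with m hm
        nlinarith [Nat.cast_nonneg (α := ℝ) (p m)])
      simp only [hexp] at h2
      have h3 := h1.add ((tendsto_one_sub_pow_exp hk h2).const_sub 1)
      rw [zero_add] at h3
      refine h3.congr fun m => ?_
      rw [survival, sub_add_cancel]
    exact ⟨hlim, hasCutoffAt_of_profile hk hlim (fun m => sylowDist_antitone (H m))
      (fun m => sylowDist_nonneg (H m)) (fun m => sylowDist_le_one (H m)),
      hasCutoffWindow_of_profile hk hlim⟩
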